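/- Let $\mathbb C$ be a regular category: it has finite limits, every morphism factors as a regular epimorphism followed by a monomorphism, and regular epimorphisms are stable under pullback. A relation $R$ from $X$ to $Y$ in $\mathbb C$ is a subobject $\langle r_1,r_2\rangle\colon R\rightarrowtail X\times Y$; its opposite $R^\circ$ is the relation $\langle r_2,r_1\rangle\colon R\rightarrowtail Y\times X$; for a relation $S$ from $Y$ to $Z$, the composite $SR$ is the relation from $X$ to $Z$ given by the image of $\langle r_1\pi_1,s_2\pi_2\rangle\colon R\times_Y S\to X\times Z$. For generalised elements $x\colon A\to X$, $y\colon A\to Y$, we write $(x,y)\in R$ when $\langle x,y\rangle\colon A\to X\times Y$ factors through $R$. A relation $R$ on $X$ (i.e. from $X$ to $X$) is reflexive if $1_X\leqslant R$, where $1_X$ is the diagonal of $X$, and an equivalence relation if moreover $R^\circ\leqslant R$ and $RR\leqslant R$. The category $\mathbb C$ is a Goursat category if $RSR=SRS$ for all equivalence relations $R$, $S$ on the same object. For relations $R,S,T$ on $X$ and generalised elements $x,y,u,v\colon A\to X$, the Shifting Lemma for $(R,S,T)$ at $(x,y,u,v)$ is the assertion: if $R\wedge S\leqslant T$, $(x,y)\in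 R\wedge T$, $(x,u)\in S$, $(y,v)\in S$ and $(u,v)\in R$, then $(u,v)\in T$. The following conditions are equivalent: 1. $\mathbb C$ is a Goursat category; 2. for every reflexive relation $E$ on any object $X$ of $\mathbb C$ and all generalised elements $z,x,y\colon A\to X$, the Shifting Lemma holds for $R=EE^\circ$, $S=E$, $T=E^\circ E$ at $(z,z,x,y)$, that is, in the diagram with top row $z\,E\,x$, bottom row $z\,E\,y$, left column from $z$ to $z$ and right column from $x$ to $y$; 3. for every reflexive relation $E$ on any object $X$ of $\mathbb C$, the Shifting Lemma holds for $R=EE^\circ$, $S=E$, $T=E^\circ E$ at all generalised elements $x,y,u,v\colon A\to X$. -/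

import Mathlib

open CategoryTheory CategoryTheory.Limits

universe v u

noncomputable section

namespace RegularRel

variable {C : Type u} [Category.{v} C] [Regular C]

/-- An internal relation from `X` to `Y`: a subobject of `X ⨯ Y`. -/
abbrev IRel (X Y : C) : Type (max u v) := Subobject (X ⨯ Y)

/-- First leg `r₁` of a relation `⟨r₁, r₂⟩ : R ⟶ X ⨯ Y`. -/
def leg₁ {X Y : C} (R : IRel X Y) : (R : C) ⟶ X := R.arrow ≫ prod.fst

/-- Second leg `r₂` of a relation `⟨r₁, r₂⟩ : R ⟶ X ⨯ Y`. -/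
def leg₂ {X Y : C} (R : IRel X Y) : (R : C) ⟶ Y := R.arrow ≫ prod.snd

instance mono_lift_leg₂_leg₁ {X Y : C} (R : IRel X Y) :
    Mono (prod.lift (leg₂ R) (leg₁ R)) := by
  have h : prod.lift (leg₂ R) (leg₁ R) = R.arrow ≫ (prod.braiding X Y).hom := by
    ext <;> simp [leg₁, leg₂]
  rw [h]
  infer_instance

/-- The generalised element `(x, y) : A ⟶ X ⨯ Y` belongs to the relation `R`. -/
def Mem {X Y A : C} (R : IRel X Y) (x : A ⟶ X) (y : A ⟶ Y) : Prop :=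
  R.Factors (prod.lift x y)

/-- The opposite relation `R°`, given by `⟨r₂, r₁⟩`. -/
def opp {X Y : C} (R : IRel X Y) : IRel Y X :=
  Subobject.mk (prod.lift (leg₂ R) (leg₁ R))

/-- The relational composite `S R` (first `R`, then `S`): the image of
`⟨r₁ π₁, s₂ π₂⟩ : R ×_Y S ⟶ X ⨯ Z`. In a regular category the image factorisation is the
factorisation as a regular epimorphism followed by a monomorphism. -/
def comp {X Y Z : C} (S : IRel Y Z) (R : IRel X Y) : IRel X Z :=
  imageSubobject
    (prod.lift (pullback.fst (leg₂ R) (leg₁ S) ≫ leg₁ R)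
      (pullback.snd (leg₂ R) (leg₁ S) ≫ leg₂ S))

/-- `1_X ≤ R`, where `1_X` is the diagonal. -/
def IsRefl {X : C} (R : IRel X X) : Prop := Subobject.mk (diag X) ≤ R

/-- `R° ≤ R`. -/
def IsSymm {X : C} (R : IRel X X) : Prop := opp R ≤ R

/-- `R R ≤ R`. -/
def IsTrans {X : C} (R : IRel X X) : Prop := comp R R ≤ R

/-- Internal equivalence relations. -/
structure IsEquivRel {X : C} (R : IRel X X) : Prop where
  refl : IsRefl R
  symm : IsSymm R
  trans : IsTrans R

variable (C) in
/-- A regular category is Goursat when it is 3-permutable: `R S R = S R S` for all equivalence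
relations `R`, `S` on the same object. -/
def IsGoursat : Prop :=
  ∀ (X : C) (R S : IRel X X), IsEquivRel R → IsEquivRel S →
    comp R (comp S R) = comp S (comp R S)

/-- The Shifting Lemma for the relations `R`, `S`, `T` on `X` at the quadrilateral with top row
`x S u`, bottom row `y S v`, left column `x (R ∧ T) y` and right column `u R v`: if `R ∧ S ≤ T`,
then `u T v`. Relations are read from left to right and from top to bottom, and `x, y, u, v` are
generalised elements of `X`. -/
def ShiftingAt {X A : C} (R S T : IRel X X) (x y u v : A ⟶ X) : Prop :=
  R ⊓ S ≤ T → Mem (R ⊓ T) x y → Mem S x u → Mem S y v → Mem R u v → Mem T u v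

variable (C) in
/-- The Shifting Lemma holds for `R = E E°`, `S = E`, `T = E° E`, with `E` any reflexive relation,
and for all quadrilaterals `x, y, u, v`. -/
def ShiftingForRefl : Prop :=
  ∀ (X : C) (E : IRel X X), IsRefl E → ∀ (A : C) (x y u v : A ⟶ X),
    ShiftingAt (comp E (opp E)) E (comp (opp E) E) x y u v

variable (C) in
/-- The Shifting Lemma holds for `R = E E°`, `S = E`, `T = E° E`, with `E` any reflexive relation,
and for the quadrilaterals with top row `z E x`, bottom row `z E y` (both left-hand vertices
equal to `z`). -/
def ShiftingForReflDiagram : Prop :=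
  ∀ (X : C) (E : IRel X X), IsRefl E → ∀ (A : C) (z x y : A ⟶ X),
    ShiftingAt (comp E (opp E)) E (comp (opp E) E) z z x y

end RegularRel

end

namespace RegularRel

variable {C : Type u} [Category.{v} C] [Regular C]

attribute [local simp] prod.lift_fst prod.lift_snd prod.lift_fst_assoc prod.lift_snd_assoc

/-! Everything passes through the inclusion `E E° ≤ E° E` for reflexive `E`, which is equivalent to
3-permutability. It yields the Shifting Lemma immediately; conversely, the degenerate quadrilaterals
`z, z, x, y` suffice to recover it. Relations are handled through generalised elements: witnesses of
a composite exist after a strong epimorphic cover, and membership descends along such covers. -/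

theorem mem_mk_iff {X Y Z A : C} {m : Z ⟶ X ⨯ Y} [Mono m] {x : A ⟶ X} {y : A ⟶ Y} :
    Mem (Subobject.mk m) x y ↔ ∃ f : A ⟶ Z, f ≫ m = prod.lift x y :=
  Subobject.mk_factors_iff _ _

theorem mem_iff_exists {X Y A : C} {R : IRel X Y} {x : A ⟶ X} {y : A ⟶ Y} :
    Mem R x y ↔ ∃ f : A ⟶ (R : C), f ≫ leg₁ R = x ∧ f ≫ leg₂ R = y := by
  constructor
  · intro (h : R.Factors _)
    refine ⟨R.factorThru _ h, ?_, ?_⟩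
    · rw [leg₁, ← Category.assoc, Subobject.factorThru_arrow, prod.lift_fst]
    · rw [leg₂, ← Category.assoc, Subobject.factorThru_arrow, prod.lift_snd]
  · rintro ⟨f, rfl, rfl⟩
    refine (Subobject.factors_iff _ _).mpr ⟨f, ?_⟩
    change f ≫ R.arrow = _
    ext <;> simp [leg₁, leg₂]

theorem mem_legs {X Y : C} (R : IRel X Y) : Mem R (leg₁ R) (leg₂ R) :=
  mem_iff_exists.mpr ⟨𝟙 _, by simp, by simp⟩

theorem Mem.precomp {X Y A B : C} {R : IRel X Y} {x : A ⟶ X} {y : A ⟶ Y} (h : Mem R x y)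
    (q : B ⟶ A) : Mem R (q ≫ x) (q ≫ y) := by
  obtain ⟨f, rfl, rfl⟩ := mem_iff_exists.mp h
  exact mem_iff_exists.mpr ⟨q ≫ f, by simp, by simp⟩

theorem Mem.mono {X Y A : C} {R S : IRel X Y} (hRS : R ≤ S) {x : A ⟶ X} {y : A ⟶ Y}
    (h : Mem R x y) : Mem S x y :=
  Subobject.factors_of_le _ hRS h

theorem le_of_forall_mem {X Y : C} {R S : IRel X Y}
    (h : ∀ (A : C) (x : A ⟶ X) (y : A ⟶ Y), Mem R x y → Mem S x y) : R ≤ S := by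
  -- The pair of legs is the universal element of `R`, so testing it suffices.
  obtain ⟨f, h₁, h₂⟩ := mem_iff_exists.mp (h _ _ _ (mem_legs R))
  refine Subobject.le_of_comm f ?_
  ext
  · simpa [leg₁] using h₁
  · simpa [leg₂] using h₂

/-- Membership in a relation is local for strong epimorphisms. -/
theorem mem_of_precomp {X Y A B : C} {R : IRel X Y} {x : A ⟶ X} {y : A ⟶ Y} (q : B ⟶ A)
    [StrongEpi q] (h : Mem R (q ≫ x) (q ≫ y)) : Mem R x y := by
  obtain ⟨f, h₁, h₂⟩ := mem_iff_exists.mp h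
  have sq : CommSq f q R.arrow (prod.lift x y) := ⟨by
    ext
    · simpa [leg₁] using h₁
    · simpa [leg₂] using h₂⟩
  exact (Subobject.factors_iff _ _).mpr ⟨sq.lift, sq.fac_right⟩

theorem mem_opp_iff {X Y A : C} {R : IRel X Y} {y : A ⟶ Y} {x : A ⟶ X} :
    Mem (opp R) y x ↔ Mem R x y := by
  rw [mem_iff_exists (R := R), opp, mem_mk_iff]
  constructor
  · rintro ⟨f, hf⟩
    have h₁ := congrArg (· ≫ prod.fst) hf
    have h₂ := congrArg (· ≫ prod.snd) hf
    exact ⟨f, by simpa using h₂, by simpa using h₁⟩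
  · rintro ⟨f, rfl, rfl⟩
    refine ⟨f, ?_⟩
    ext <;> simp

instance strongEpi_pullback_fst {X Y Z : C} (f : X ⟶ Z) (g : Y ⟶ Z) [StrongEpi g] :
    StrongEpi (pullback.fst f g) := by
  have : IsRegularEpi g := inferInstance
  infer_instance

/-- Membership in a composite relation, in the internal language of a regular category. -/
theorem mem_comp_iff {X Y Z A : C} {S : IRel Y Z} {R : IRel X Y} {x : A ⟶ X} {z : A ⟶ Z} :
    Mem (comp S R) x z ↔
      ∃ (B : C) (q : B ⟶ A) (_ : StrongEpi q) (y : B ⟶ Y), Mem R (q ≫ x) y ∧ Mem S y (q ≫ z) := by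
  constructor
  · intro h
    let m := prod.lift (pullback.fst (leg₂ R) (leg₁ S) ≫ leg₁ R)
      (pullback.snd (leg₂ R) (leg₁ S) ≫ leg₂ S)
    have hm : Mem (imageSubobject m) x z := h
    -- The cover is the pullback along `f` of the epimorphic part of the image factorisation.
    obtain ⟨f, hf⟩ := mem_mk_iff.mp hm
    have hp := pullback.condition (f := f) (g := factorThruImage m)
    have hq : pullback.fst f (factorThruImage m) ≫ prod.lift x z =
        pullback.snd f (factorThruImage m) ≫ m := by
      rw [← hf, ← Category.assoc, hp, Category.assoc, image.fac]
    have h₁ := congrArg (· ≫ prod.fst) hq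
    have h₂ := congrArg (· ≫ prod.snd) hq
    simp only [m, Category.assoc, prod.lift_fst, prod.lift_snd] at h₁ h₂
    refine ⟨_, pullback.fst f (factorThruImage m), strongEpi_pullback_fst _ _,
      pullback.snd f (factorThruImage m) ≫ pullback.fst (leg₂ R) (leg₁ S) ≫ leg₂ R, ?_, ?_⟩
    · rw [h₁]
      exact ((mem_legs R).precomp _).precomp _
    · rw [h₂, pullback.condition]
      exact ((mem_legs S).precomp _).precomp _
  · rintro ⟨B, q, _, y, hR, hS⟩
    refine mem_of_precomp q ?_
    obtain ⟨f, hf₁, hf₂⟩ := mem_iff_exists.mp hR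
    obtain ⟨g, hg₁, hg₂⟩ := mem_iff_exists.mp hS
    have h := imageSubobject_factors_comp_self
      (f := prod.lift (pullback.fst (leg₂ R) (leg₁ S) ≫ leg₁ R)
        (pullback.snd (leg₂ R) (leg₁ S) ≫ leg₂ S)) (pullback.lift f g (hf₂.trans hg₁.symm))
    simpa [Mem, comp, prod.comp_lift, hf₁, hg₂, pullback.lift_fst_assoc,
      pullback.lift_snd_assoc] using h

theorem mem_comp {X Y Z A : C} {S : IRel Y Z} {R : IRel X Y} {x : A ⟶ X} {y : A ⟶ Y} {z : A ⟶ Z}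
    (hR : Mem R x y) (hS : Mem S y z) : Mem (comp S R) x z :=
  mem_comp_iff.mpr ⟨A, 𝟙 A, inferInstance, y, by simpa using hR, by simpa using hS⟩

/-- The middle elements of a threefold composite exist on a common cover. -/
theorem exists_of_mem_comp_comp {X Y Z W A : C} {T : IRel Z W} {S : IRel Y Z} {R : IRel X Y}
    {x : A ⟶ X} {w : A ⟶ W} (h : Mem (comp T (comp S R)) x w) :
    ∃ (B : C) (q : B ⟶ A) (_ : StrongEpi q) (y : B ⟶ Y) (z : B ⟶ Z),
      Mem R (q ≫ x) y ∧ Mem S y z ∧ Mem T z (q ≫ w) := by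
  obtain ⟨B, q, _, z, h, hT⟩ := mem_comp_iff.mp h
  obtain ⟨B', q', _, y, hR, hS⟩ := mem_comp_iff.mp h
  exact ⟨B', q' ≫ q, strongEpi_comp _ _, y, q' ≫ z, by simpa using hR, hS,
    by simpa using hT.precomp q'⟩

theorem isRefl_iff {X : C} {R : IRel X X} :
    IsRefl R ↔ ∀ (A : C) (x : A ⟶ X), Mem R x x := by
  constructor
  · intro h A x
    refine Mem.mono h (mem_mk_iff.mpr ⟨x, ?_⟩)
    ext <;> simp
  · intro h
    obtain ⟨f, h₁, h₂⟩ := mem_iff_exists.mp (h X (𝟙 X))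
    refine Subobject.mk_le_of_comm f ?_
    ext
    · simpa [leg₁] using h₁
    · simpa [leg₂] using h₂

theorem isSymm_iff {X : C} {R : IRel X X} :
    IsSymm R ↔ ∀ (A : C) (x y : A ⟶ X), Mem R x y → Mem R y x :=
  ⟨fun h _ _ _ hxy => Mem.mono h (mem_opp_iff.mpr hxy),
    fun h => le_of_forall_mem fun _ _ _ hxy => h _ _ _ (mem_opp_iff.mp hxy)⟩

theorem isTrans_iff {X : C} {R : IRel X X} :
    IsTrans R ↔ ∀ (A : C) (x y z : A ⟶ X), Mem R x y → Mem R y z → Mem R x z := by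
  refine ⟨fun h _ _ _ _ hxy hyz => Mem.mono h (mem_comp hxy hyz), fun h => ?_⟩
  refine le_of_forall_mem fun A x z hxz => ?_
  obtain ⟨B, q, _, y, hxy, hyz⟩ := mem_comp_iff.mp hxz
  exact mem_of_precomp q (h _ _ _ _ hxy hyz)

instance mono_lift_pullback {X Y : C} (f : X ⟶ Y) :
    Mono (prod.lift (pullback.fst f f) (pullback.snd f f)) where
  right_cancellation a b h := by
    have h₁ := congrArg (· ≫ prod.fst) h
    have h₂ := congrArg (· ≫ prod.snd) h
    exact pullback.hom_ext (by simpa using h₁) (by simpa using h₂)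

/-- The kernel pair of a morphism, as an internal relation. -/
noncomputable def kernelRel {X Y : C} (f : X ⟶ Y) : IRel X X :=
  Subobject.mk (prod.lift (pullback.fst f f) (pullback.snd f f))

theorem mem_kernelRel_iff {X Y A : C} {f : X ⟶ Y} {x y : A ⟶ X} :
    Mem (kernelRel f) x y ↔ x ≫ f = y ≫ f := by
  rw [kernelRel, mem_mk_iff]
  constructor
  · rintro ⟨g, hg⟩
    have h₁ : g ≫ pullback.fst f f = x := by simpa using congrArg (· ≫ prod.fst) hg
    have h₂ : g ≫ pullback.snd f f = y := by simpa using congrArg (· ≫ prod.snd) hg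
    rw [← h₁, ← h₂, Category.assoc, Category.assoc, pullback.condition]
  · intro h
    refine ⟨pullback.lift x y h, ?_⟩
    ext <;> simp [pullback.lift_fst, pullback.lift_snd]

theorem isEquivRel_kernelRel {X Y : C} (f : X ⟶ Y) : IsEquivRel (kernelRel f) where
  refl := isRefl_iff.mpr fun _ _ => mem_kernelRel_iff.mpr rfl
  symm := isSymm_iff.mpr fun _ _ _ h => mem_kernelRel_iff.mpr (mem_kernelRel_iff.mp h).symm
  trans := isTrans_iff.mpr fun _ _ _ _ h h' =>
    mem_kernelRel_iff.mpr ((mem_kernelRel_iff.mp h).trans (mem_kernelRel_iff.mp h'))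

theorem IsRefl.opp {X : C} {E : IRel X X} (hE : IsRefl E) : IsRefl (opp E) :=
  isRefl_iff.mpr fun A x => mem_opp_iff.mpr (isRefl_iff.mp hE A x)

theorem IsRefl.comp {X : C} {R S : IRel X X} (hS : IsRefl S) (hR : IsRefl R) :
    IsRefl (comp S R) :=
  isRefl_iff.mpr fun A x => mem_comp (isRefl_iff.mp hR A x) (isRefl_iff.mp hS A x)

/-- In a Goursat category, `E E° ≤ E° E` for every reflexive relation `E`: apply 3-permutability
to the kernel pairs of the two legs of `E`. -/
theorem IsGoursat.comp_opp_le (h : IsGoursat C) {X : C} {E : IRel X X} (hE : IsRefl E) :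
    comp E (opp E) ≤ comp (opp E) E := by
  refine le_of_forall_mem fun A x y hxy => ?_
  obtain ⟨B, q, _, z, hzx, hzy⟩ := mem_comp_iff.mp hxy
  obtain ⟨a, ha₁, ha₂⟩ := mem_iff_exists.mp (mem_opp_iff.mp hzx)
  obtain ⟨b, hb₁, hb₂⟩ := mem_iff_exists.mp hzy
  obtain ⟨c, hc₁, hc₂⟩ := mem_iff_exists.mp (isRefl_iff.mp hE _ (q ≫ x))
  obtain ⟨d, hd₁, hd₂⟩ := mem_iff_exists.mp (isRefl_iff.mp hE _ (q ≫ y))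
  -- As elements of `E`: `c = (x, x)`, `a = (z, x)`, `b = (z, y)`, `d = (y, y)`; neighbours share
  -- alternately second, first, second coordinates.
  have hcd : Mem (comp (kernelRel (leg₂ E)) (comp (kernelRel (leg₁ E)) (kernelRel (leg₂ E)))) c d :=
    mem_comp (mem_comp (mem_kernelRel_iff.mpr (hc₂.trans ha₂.symm))
      (mem_kernelRel_iff.mpr (ha₁.trans hb₁.symm))) (mem_kernelRel_iff.mpr (hb₂.trans hd₂.symm))
  rw [h _ _ _ (isEquivRel_kernelRel _) (isEquivRel_kernelRel _)] at hcd
  obtain ⟨B', q', _, e, e', h₁, h₂, h₃⟩ := exists_of_mem_comp_comp hcd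
  rw [mem_kernelRel_iff, Category.assoc] at h₁ h₃
  rw [mem_kernelRel_iff] at h₂
  -- Now `e = (x, w)` and `e' = (y, w)` with a common `w`.
  refine mem_of_precomp q (mem_of_precomp q' (mem_comp (y := e ≫ leg₂ E) ?_ (mem_opp_iff.mpr ?_)))
  · exact mem_iff_exists.mpr ⟨e, by rw [← h₁, hc₁], rfl⟩
  · exact mem_iff_exists.mpr ⟨e', by rw [h₃, hd₁], h₂.symm⟩

/-- Take `E = R S`, which is reflexive. From `x R a S b R y` come `b E x` and `b E y`, so the
inclusion gives `w` with `x E w` and `y E w`. Unfolding, `x S c R w R d S y`, and transitivity of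
`R` removes `w`. -/
theorem comp_comp_le_of_comp_opp_le {X : C}
    (h : ∀ E : IRel X X, IsRefl E → comp E (opp E) ≤ comp (opp E) E)
    {R S : IRel X X} (hR : IsEquivRel R) (hS : IsEquivRel S) :
    comp R (comp S R) ≤ comp S (comp R S) := by
  have hRs := isSymm_iff.mp hR.symm
  have hSs := isSymm_iff.mp hS.symm
  refine le_of_forall_mem fun A x y hxy => ?_
  obtain ⟨B, q, _, a, b, hxa, hab, hby⟩ := exists_of_mem_comp_comp hxy
  have hbx : Mem (comp R S) b (q ≫ x) := mem_comp (hSs _ _ _ hab) (hRs _ _ _ hxa)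
  have hby' : Mem (comp R S) b (q ≫ y) := mem_comp (isRefl_iff.mp hS.refl _ _) hby
  obtain ⟨B', q', _, w, hxw, hyw⟩ := mem_comp_iff.mp
    (Mem.mono (h _ (hR.refl.comp hS.refl)) (mem_comp (mem_opp_iff.mpr hbx) hby'))
  obtain ⟨B₁, q₁, _, c, hxc, hcw⟩ := mem_comp_iff.mp hxw
  obtain ⟨B₂, q₂, _, d, hyd, hdw⟩ := mem_comp_iff.mp ((mem_opp_iff.mp hyw).precomp q₁)
  refine mem_of_precomp q (mem_of_precomp q' (mem_of_precomp q₁ (mem_of_precomp q₂ ?_)))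
  exact mem_comp (mem_comp (hxc.precomp q₂)
    (isTrans_iff.mp hR.trans _ _ _ _ (hcw.precomp q₂) (hRs _ _ _ hdw))) (hSs _ _ _ hyd)

theorem isGoursat_of_comp_opp_le
    (h : ∀ (X : C) (E : IRel X X), IsRefl E → comp E (opp E) ≤ comp (opp E) E) : IsGoursat C :=
  fun X _ _ hR hS => le_antisymm (comp_comp_le_of_comp_opp_le (h X) hR hS)
    (comp_comp_le_of_comp_opp_le (h X) hS hR)

theorem IsRefl.le_opp_comp {X : C} {E : IRel X X} (hE : IsRefl E) :
    E ≤ RegularRel.comp (RegularRel.opp E) E :=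
  le_of_forall_mem fun A _ y hxy => mem_comp hxy (mem_opp_iff.mpr (isRefl_iff.mp hE A y))

/-- The apex `z` witnessing `x E E° y` serves as both left-hand vertices. Reflexivity supplies the
left column and `E ≤ E° E`, hence `R ∧ S ≤ T`. -/
theorem ShiftingForReflDiagram.comp_opp_le (h : ShiftingForReflDiagram C) {X : C} {E : IRel X X}
    (hE : IsRefl E) : comp E (opp E) ≤ comp (opp E) E := by
  refine le_of_forall_mem fun A x y hxy => ?_
  obtain ⟨B, q, _, z, hzx, hzy⟩ := mem_comp_iff.mp hxy
  refine mem_of_precomp q (h X E hE B z _ _ (inf_le_right.trans hE.le_opp_comp) ?_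
    (mem_opp_iff.mp hzx) hzy (hxy.precomp q))
  exact (Subobject.inf_factors _).mpr ⟨isRefl_iff.mp (hE.comp hE.opp) B z,
    isRefl_iff.mp (hE.opp.comp hE) B z⟩

end RegularRel

theorem corollary3p7 (C : Type u) [Category.{v} C] [Regular C] :
    List.TFAE [RegularRel.IsGoursat C, RegularRel.ShiftingForReflDiagram C,
      RegularRel.ShiftingForRefl C] := by
  tfae_have 1 → 3 := fun h _ _ hE _ _ _ _ _ _ _ _ _ huv => huv.mono (h.comp_opp_le hE)
  tfae_have 3 → 2 := fun h X E hE A z x y => h X E hE A z z x y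
  tfae_have 2 → 1 := fun h => RegularRel.isGoursat_of_comp_opp_le fun _ _ hE => h.comp_opp_le hE
  tfae_finish
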